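/- For positive integers $a\ge 2$ put $\zeta(a)=\sum_{m>0}m^{-a}$, and for integers $a\ge 1$, $b\ge 2$ let $$\zeta(a,b)=\sum_{0<m_1<m_2}\frac{1}{m_1^{a}m_2^{b}}$$ be the double zeta value. Let $B_n$ be the $n$th Bernoulli number (with $B_1=-\tfrac12$). Let $k=2K+1\ge 5$ be an odd integer, let $\mathcal A$ be the $(K-1)\times(K-1)$ matrix with entries $$\mathcal A_{r,s}=\binom{2K-2s}{2r-1}+\binom{2K-2s}{2K-2r}\qquad(1\le r,s\le K-1),$$ and let $\mathcal C=\mathcal A^{T}$. Then $\mathcal C$ is invertible over $\mathbb Q$; for all $1\le r,s\le K-1$ its inverse has the entries $$(\mathcal C^{-1})_{r,s}=\frac{-2}{2s-1}\sum_{n=0}^{k-2s}\binom{k-2r-1}{k-2s-n}\binom{n+2s-2}{n}B_n=\frac{2}{2s-1}\sum_{n=0}^{k-2s}\binom{2r-1}{k-2s-n}\binom{n+2s-2}{n}B_n;$$ and for every $1\le s\le K-1$ $$\zeta(2s)\,\zeta(k-2s)\equiv\sum_{r=1}^{K-1}(\mathcal C^{-1})_{r,s}\,\zeta(2r,k-2r)\pmod{\mathbb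 Q\,\zeta(k)},$$ that is, the difference of the two sides is a rational multiple of $\zeta(k)$. -/

import Mathlib

/-- The zeta value `ζ(a) = ∑_{0 < m} 1 / m ^ a` (convergent for `a ≥ 2`). -/
noncomputable def zetaValue (a : ℕ) : ℝ :=
  ∑' m : ℕ, 1 / ((m + 1 : ℕ) : ℝ) ^ a

/-- The double zeta value `ζ(a, b) = ∑_{0 < m₁ < m₂} 1 / (m₁ ^ a m₂ ^ b)`
(convergent for `a ≥ 1`, `b ≥ 2`). -/
noncomputable def doubleZeta (a b : ℕ) : ℝ :=
  ∑' m : {m : ℕ × ℕ // 0 < m.1 ∧ m.1 < m.2},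
    1 / ((m.1.1 : ℝ) ^ a * (m.1.2 : ℝ) ^ b)

/-- `zetaValue` is the Riemann zeta function at integers `a ≥ 2`. -/
theorem zetaValue_eq_riemannZeta {a : ℕ} (ha : 2 ≤ a) :
    ((zetaValue a : ℝ) : ℂ) = riemannZeta a := by
  rw [zeta_nat_eq_tsum_of_gt_one (by omega), zetaValue]
  have h : Summable (fun n : ℕ => 1 / ((n : ℕ) : ℝ) ^ a) :=
    Real.summable_one_div_nat_pow.mpr (by omega)
  have h0 := h.tsum_eq_zero_add
  rw [Nat.cast_zero, zero_pow (by omega : a ≠ 0), div_zero, zero_add] at h0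
  rw [← h0]
  push_cast
  rfl

/-- The double series converges absolutely in the range in which it is used. -/
theorem summable_doubleZeta {a b : ℕ} (ha : 2 ≤ a) (hb : 2 ≤ b) :
    Summable (fun m : {m : ℕ × ℕ // 0 < m.1 ∧ m.1 < m.2} =>
      1 / ((m.1.1 : ℝ) ^ a * (m.1.2 : ℝ) ^ b)) := by
  have h1 : Summable (fun n : ℕ => 1 / (n : ℝ) ^ a) :=
    Real.summable_one_div_nat_pow.mpr (by omega)
  have h2 : Summable (fun n : ℕ => 1 / (n : ℝ) ^ b) :=
    Real.summable_one_div_nat_pow.mpr (by omega)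
  have h := h1.mul_of_nonneg h2 (fun n => by positivity) (fun n => by positivity)
  refine (h.subtype {m : ℕ × ℕ | 0 < m.1 ∧ m.1 < m.2}).congr ?_
  intro m
  simp [one_div, mul_comm]

/-- The index set `{1, …, K - 1}` of rows and columns. -/
abbrev ZIdx (K : ℕ) : Type := {i : ℕ // i ∈ Finset.Icc 1 (K - 1)}

/-- The matrix `𝒜_K`, of size `(K - 1) × (K - 1)`, with entries
`binom(2K - 2s, 2r - 1) + binom(2K - 2s, 2K - 2r)`. For `1 ≤ r, s ≤ K - 1` no subtraction
truncates. -/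
def matA (K : ℕ) : Matrix (ZIdx K) (ZIdx K) ℚ :=
  Matrix.of fun r s =>
    ((2 * K - 2 * s.1).choose (2 * r.1 - 1) : ℚ) +
      ((2 * K - 2 * s.1).choose (2 * K - 2 * r.1) : ℚ)

/-- The matrix `𝒞`, the transpose of `𝒜_K`. -/
def matC (K : ℕ) : Matrix (ZIdx K) (ZIdx K) ℚ := (matA K).transpose

/-! Two independent arguments meet in the matrix 𝒞. Algebra: `bernoulliTransform (2K) e` is a
discrete antiderivative of (1+x)^e x^(2K-1-e). Combining those with e = 2K-2s along row r of 𝒞 gives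
a polynomial G with explicit difference D(x) = G(x+1) - G(x). Under x ↦ -1-x almost all of D
cancels, and G(x) - G(-x) = x^(2K-1) - x^(2r-1). Reading off odd coefficients below 2K-1 yields the
inverse (`matC_mul_matCInv`). The same reflection relates the exponents 2K-2r and 2r-1, hence the
two formulas (`bernoulliTransform_coeff_add`). Analysis: sum p^(-a) q^(-b) over nonzero integers
with p+q > 0 in two ways. By signs it is a combination of ζ(a)ζ(b), ζ(a,b) and ζ(b,a). Along the
lines p+q = n, partial fractions leave only sums over all of ℤ, where odd powers cancel, so products
ζ(even)ζ(odd) and a rational multiple of ζ(k) remain (`half_plane_sum_eq`). This expresses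
ζ(2r,k-2r) through 𝒞 (`exists_doubleZeta_eq`), and inverting 𝒞 finishes. -/

/-! ### Bernoulli polynomials and difference equations -/

open Polynomial in
/-- The image of `(1 + y) ^ e` under the linear map `y ^ j ↦ B_{N - j}(X) / (N - j)`. -/
noncomputable def bernoulliTransform (N e : ℕ) : ℚ[X] :=
  ∑ j ∈ Finset.range (e + 1), C ((e.choose j : ℚ) / ((N - j : ℕ) : ℚ)) *
    Polynomial.bernoulli (N - j)

-- Since B_n(1+x) - B_n(x) = n x^(n-1), the difference is ∑ binom(e,j) x^(N-1-j), which the binomial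
-- theorem sums. The bound e < N keeps every denominator N-j nonzero.
open Polynomial in
theorem eval_one_add_bernoulliTransform {N e : ℕ} (h : e < N) (x : ℚ) :
    (bernoulliTransform N e).eval (1 + x) =
      (bernoulliTransform N e).eval x + (1 + x) ^ e * x ^ (N - 1 - e) := by
  simp only [bernoulliTransform, eval_finsetSum, eval_mul, eval_C, bernoulli_eval_one_add,
    mul_add, Finset.sum_add_distrib]
  congr 1
  rw [add_pow, Finset.sum_mul]
  refine Finset.sum_congr rfl fun j hj => ?_
  rw [Finset.mem_range] at hj
  have h0 : ((N - j : ℕ) : ℚ) ≠ 0 := by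
    have : N - j ≠ 0 := by omega
    exact_mod_cast this
  have hp : N - j - 1 = (e - j) + (N - 1 - e) := by omega
  rw [hp, pow_add, one_pow]
  field_simp

theorem choose_succ_succ_div_eq (n m : ℕ) :
    ((n + m + 1).choose (m + 1) : ℚ) / ((n + m + 1 : ℕ) : ℚ) =
      1 / ((m + 1 : ℕ) : ℚ) * ((n + m).choose n : ℚ) := by
  have h := Nat.add_one_mul_choose_eq (n + m) m
  have h1 : (n + m).choose n = (n + m).choose m := by
    rw [Nat.choose_symm_add]
  have h2 : ((n + m + 1 : ℕ) : ℚ) ≠ 0 := by positivity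
  have h3 : ((m + 1 : ℕ) : ℚ) ≠ 0 := by positivity
  rw [h1]
  field_simp
  exact_mod_cast (by linarith : (n + m + 1).choose (m + 1) * (m + 1) =
    (n + m + 1) * (n + m).choose m)

theorem coeff_bernoulliTransform {N e t : ℕ} (ht : 1 ≤ t) (htN : 2 * t ≤ N) :
    (bernoulliTransform N e).coeff (2 * t - 1) =
      1 / (2 * (t : ℚ) - 1) * ∑ n ∈ Finset.range (N + 1 - 2 * t + 1),
        (e.choose (N + 1 - 2 * t - n) : ℚ) * ((n + 2 * t - 2).choose n : ℚ) * bernoulli n := by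
  have hcast : (2 * (t : ℚ) - 1) = ((2 * t - 2 + 1 : ℕ) : ℚ) := by
    obtain ⟨u, rfl⟩ := Nat.exists_eq_add_of_le ht
    rw [show 2 * (1 + u) - 2 + 1 = 2 * u + 1 by omega]
    push_cast; ring
  rw [← Finset.sum_range_reflect, Finset.mul_sum]
  rw [bernoulliTransform, Polynomial.finsetSum_coeff]
  simp only [Polynomial.coeff_C_mul]
  have hf : ∀ j, j ≤ N + 1 - 2 * t →
      (e.choose j : ℚ) / ((N - j : ℕ) : ℚ) * (Polynomial.bernoulli (N - j)).coeff (2 * t - 1) =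
      1 / (2 * (t : ℚ) - 1) * ((e.choose (N + 1 - 2 * t - (N + 1 - 2 * t + 1 - 1 - j)) : ℚ) *
        ((N + 1 - 2 * t + 1 - 1 - j + 2 * t - 2).choose (N + 1 - 2 * t + 1 - 1 - j) : ℚ) *
        bernoulli (N + 1 - 2 * t + 1 - 1 - j)) := by
    intro j hj
    obtain ⟨n, hn⟩ : ∃ n, n = N + 1 - 2 * t - j := ⟨_, rfl⟩
    rw [show N + 1 - 2 * t + 1 - 1 - j = n by omega, show N + 1 - 2 * t - n = j by omega,
      show N - j = n + (2 * t - 2) + 1 by omega, show n + 2 * t - 2 = n + (2 * t - 2) by omega,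
      Polynomial.coeff_bernoulli, if_pos (by omega), hcast,
      show n + (2 * t - 2) + 1 - (2 * t - 1) = n by omega]
    have := choose_succ_succ_div_eq n (2 * t - 2)
    rw [show 2 * t - 1 = 2 * t - 2 + 1 by omega]
    linear_combination (e.choose j : ℚ) * bernoulli n * this
  have hs : ∀ j, N + 1 - 2 * t < j → j ≤ e →
      (Polynomial.bernoulli (N - j)).coeff (2 * t - 1) = 0 := by
    intro j h1 h2
    rw [Polynomial.coeff_bernoulli, if_neg (by omega)]
  -- Both sums extend to a common range: the binomial vanishes for j > e, and the Bernoulli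
  -- polynomial has too small a degree for j > N+1-2t.
  trans ∑ j ∈ Finset.range (max (e + 1) (N + 1 - 2 * t + 1)),
      (e.choose j : ℚ) / ((N - j : ℕ) : ℚ) * (Polynomial.bernoulli (N - j)).coeff (2 * t - 1)
  · refine Finset.sum_subset (Finset.range_mono (le_max_left _ _)) fun j _ h2 => ?_
    rw [Finset.mem_range, not_lt] at h2
    rw [Nat.choose_eq_zero_of_lt (by omega)]; simp
  · symm
    refine Finset.sum_subset_zero_on_sdiff (Finset.range_mono (le_max_right _ _)) ?_ ?_
    · intro j hj
      simp only [Finset.mem_sdiff, Finset.mem_range, not_lt, lt_max_iff] at hj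
      rw [hs j (by omega) (by omega), mul_zero]
    · intro j hj
      rw [Finset.mem_range] at hj
      exact (hf j (by omega)).symm

open Polynomial in
theorem eq_of_eval_one_add_sub_eq {P Q : ℚ[X]} (h0 : P.eval 0 = Q.eval 0)
    (h : ∀ x : ℚ, P.eval (1 + x) - P.eval x = Q.eval (1 + x) - Q.eval x) : P = Q := by
  have hn : ∀ n : ℕ, P.eval (n : ℚ) = Q.eval (n : ℚ) := by
    intro n
    induction n with
    | zero => simpa using h0
    | succ n ih =>
      have := h n
      rw [ih] at this
      push_cast
      rw [add_comm (n : ℚ) 1]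
      linarith
  refine eq_of_infinite_eval_eq _ _ ((Set.infinite_range_of_injective
    (Nat.cast_injective (R := ℚ))).mono ?_)
  rintro _ ⟨n, rfl⟩
  exact hn n

open Polynomial in
/-- The odd part of `G` is determined by the antisymmetrised difference of `G`. -/
theorem sub_comp_neg_eq {G Q : ℚ[X]} {D : ℚ → ℚ}
    (hG : ∀ x, G.eval (1 + x) = G.eval x + D x)
    (hQ0 : Q.eval 0 = 0)
    (hQ : ∀ x, D x + D (-(1 + x)) = Q.eval (1 + x) - Q.eval x) :
    G - G.comp (-X) = Q := by
  refine eq_of_eval_one_add_sub_eq (by simp [hQ0]) fun x => ?_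
  rw [← hQ]
  simp only [eval_sub, eval_comp, eval_neg, eval_X]
  have h1 := hG x
  -- The reflection x ↦ -1-x maps the pair {x, 1+x} to {-1-x, -x}, so adding the two difference
  -- equations gives one for G(x) - G(-x).
  have h2 := hG (-(1 + x))
  rw [show 1 + -(1 + x) = -x by ring] at h2
  linarith

open Polynomial in
theorem coeff_sub_comp_neg_odd (G : ℚ[X]) {m : ℕ} (hm : Odd m) :
    (G - G.comp (-X)).coeff m = 2 * G.coeff m := by
  rw [show (-X : ℚ[X]) = C (-1) * X by simp, coeff_sub, comp_C_mul_X_coeff, hm.neg_one_pow]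
  ring

/-! ### Generating polynomials of the rows of 𝒞 -/

theorem matC_apply {K : ℕ} (r s : ZIdx K) :
    matC K r s = ((2 * K - 2 * r.1).choose (2 * s.1 - 1) : ℚ) +
      ((2 * K - 2 * r.1).choose (2 * K - 2 * s.1) : ℚ) := rfl

theorem two_mul_sum_even_choose {R : Type*} [CommRing R] (m : ℕ) (x y : R) (L : ℕ)
    (h : m ≤ 2 * L + 1) :
    2 * ∑ i ∈ Finset.range (L + 1), (m.choose (2 * i) : R) * x ^ (2 * i) * y ^ (m - 2 * i) =
      (x + y) ^ m + (-x + y) ^ m := by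
  have key : ∀ z : R, (z + y) ^ m =
      ∑ i ∈ Finset.range (L + 1), ((m.choose (2 * i) : R) * z ^ (2 * i) * y ^ (m - 2 * i) +
        (m.choose (2 * i + 1) : R) * z ^ (2 * i + 1) * y ^ (m - (2 * i + 1))) := by
    intro z
    have h2 : (z + y) ^ m =
        ∑ j ∈ Finset.range (2 * (L + 1)), (m.choose j : R) * z ^ j * y ^ (m - j) := by
      rw [add_pow]
      refine (Finset.sum_subset (Finset.range_mono (by omega)) fun j _ h2 => ?_).trans
        (Finset.sum_congr rfl fun j _ => by ring)
      rw [Finset.mem_range, not_lt] at h2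
      rw [Nat.choose_eq_zero_of_lt (by omega)]; simp
    rw [h2]
    generalize L + 1 = M
    induction M with
    | zero => simp
    | succ M ih =>
      rw [show 2 * (M + 1) = 2 * M + 1 + 1 by ring, Finset.sum_range_succ,
        Finset.sum_range_succ, ih, Finset.sum_range_succ]
      ring
  rw [key x, key (-x), ← Finset.sum_add_distrib, Finset.mul_sum]
  refine Finset.sum_congr rfl fun i _ => ?_
  rw [(even_two_mul i).neg_pow, (odd_two_mul_add_one i).neg_pow]
  ring

theorem two_mul_sum_odd_choose {R : Type*} [CommRing R] (m : ℕ) (x y : R) (L : ℕ)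
    (h : m ≤ 2 * L) :
    2 * ∑ i ∈ Finset.range L, (m.choose (2 * i + 1) : R) * y ^ (2 * i + 1) * x ^ (m - (2 * i + 1)) =
      (y + x) ^ m - (-y + x) ^ m := by
  have key : ∀ z : R, (z + x) ^ m =
      x ^ m + ∑ i ∈ Finset.range L, ((m.choose (2 * i + 1) : R) * z ^ (2 * i + 1) *
        x ^ (m - (2 * i + 1)) + (m.choose (2 * i + 2) : R) * z ^ (2 * i + 2) *
        x ^ (m - (2 * i + 2))) := by
    intro z
    have h2 : (z + x) ^ m =
        ∑ j ∈ Finset.range (2 * L + 1), (m.choose j : R) * z ^ j * x ^ (m - j) := by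
      rw [add_pow]
      refine (Finset.sum_subset (Finset.range_mono (by omega)) fun j _ h2 => ?_).trans
        (Finset.sum_congr rfl fun j _ => by ring)
      rw [Finset.mem_range, not_lt] at h2
      rw [Nat.choose_eq_zero_of_lt (by omega)]; simp
    rw [h2]
    clear h2 h
    induction L with
    | zero => simp
    | succ M ih =>
      rw [show 2 * (M + 1) + 1 = 2 * M + 1 + 1 + 1 by ring, Finset.sum_range_succ,
        Finset.sum_range_succ, ih, Finset.sum_range_succ]
      ring
  rw [key y, key (-y), add_sub_add_left_eq_sub, ← Finset.sum_sub_distrib, Finset.mul_sum]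
  refine Finset.sum_congr rfl fun i _ => ?_
  rw [show 2 * i + 2 = 2 * (i + 1) by ring, (even_two_mul _).neg_pow,
    (odd_two_mul_add_one i).neg_pow]
  ring

/-- The generating polynomial of a row of `𝒞`. -/
theorem two_mul_sum_matC {K r : ℕ} (hr : 1 ≤ r) (hrK : r < K) (x y : ℚ) :
    2 * ∑ s ∈ Finset.Icc 1 (K - 1), (((2 * K - 2 * r).choose (2 * s - 1) : ℚ) +
        ((2 * K - 2 * r).choose (2 * K - 2 * s) : ℚ)) * (x ^ (2 * K - 2 * s) * y ^ (2 * s - 1)) =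
      (x + y) ^ (2 * K - 2 * r) * (y ^ (2 * r - 1) + x ^ (2 * r - 1)) +
        (x - y) ^ (2 * K - 2 * r) * (y ^ (2 * r - 1) - x ^ (2 * r - 1)) - 2 * y ^ (2 * K - 1) := by
  have hIcc : Finset.Icc 1 (K - 1) = Finset.Ico 1 K := by
    ext; simp only [Finset.mem_Icc, Finset.mem_Ico]; omega
  have h1 : ∑ s ∈ Finset.Icc 1 (K - 1), ((2 * K - 2 * r).choose (2 * s - 1) : ℚ) *
      (x ^ (2 * K - 2 * s) * y ^ (2 * s - 1)) =
      x ^ (2 * r - 1) * ∑ i ∈ Finset.range (K - 1), ((2 * K - 2 * r).choose (2 * i + 1) : ℚ) *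
        y ^ (2 * i + 1) * x ^ (2 * K - 2 * r - (2 * i + 1)) := by
    rw [hIcc, Finset.sum_Ico_eq_sum_range, Finset.mul_sum]
    refine Finset.sum_congr rfl fun i hi => ?_
    rw [Finset.mem_range] at hi
    rw [show 2 * (1 + i) - 1 = 2 * i + 1 by omega]
    by_cases hc : 2 * i + 1 ≤ 2 * K - 2 * r
    · rw [show 2 * K - 2 * (1 + i) = 2 * r - 1 + (2 * K - 2 * r - (2 * i + 1)) by omega, pow_add]
      ring
    · rw [Nat.choose_eq_zero_of_lt (by omega)]; simp
  have h2 : ∑ s ∈ Finset.Icc 1 (K - 1), ((2 * K - 2 * r).choose (2 * K - 2 * s) : ℚ) *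
      (x ^ (2 * K - 2 * s) * y ^ (2 * s - 1)) =
      y ^ (2 * r - 1) * ∑ i ∈ Finset.range (K - 1 + 1), ((2 * K - 2 * r).choose (2 * i) : ℚ) *
        x ^ (2 * i) * y ^ (2 * K - 2 * r - 2 * i) - y ^ (2 * K - 1) := by
    -- The index i = 0 corresponds to s = K, outside the matrix; it is the source of the correction
    -- y^(2K-1).
    rw [Finset.sum_range_succ', mul_add, Finset.mul_sum]
    rw [show y ^ (2 * r - 1) * (((2 * K - 2 * r).choose (2 * 0) : ℚ) * x ^ (2 * 0) *
      y ^ (2 * K - 2 * r - 2 * 0)) = y ^ (2 * K - 1) by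
        rw [show 2 * K - 1 = 2 * r - 1 + (2 * K - 2 * r - 2 * 0) by omega, pow_add]; simp,
      add_sub_cancel_right, hIcc, Finset.sum_Ico_eq_sum_range, ← Finset.sum_range_reflect]
    refine Finset.sum_congr rfl fun i hi => ?_
    rw [Finset.mem_range] at hi
    rw [show 2 * K - 2 * (1 + (K - 1 - 1 - i)) = 2 * (i + 1) by omega]
    by_cases hc : 2 * (i + 1) ≤ 2 * K - 2 * r
    · rw [show 2 * (1 + (K - 1 - 1 - i)) - 1 = 2 * r - 1 + (2 * K - 2 * r - 2 * (i + 1)) by omega,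
        pow_add]
      ring
    · rw [Nat.choose_eq_zero_of_lt (by omega)]; simp
  simp only [add_mul, Finset.sum_add_distrib]
  rw [h1, h2]
  have h3 := two_mul_sum_odd_choose (2 * K - 2 * r) x y (K - 1) (by omega)
  have h4 := two_mul_sum_even_choose (2 * K - 2 * r) x y (K - 1) (by omega)
  have hev : Even (2 * K - 2 * r) := ⟨K - r, by omega⟩
  rw [show -y + x = x - y by ring, add_comm y x] at h3
  rw [show -x + y = -(x - y) by ring, hev.neg_pow] at h4
  linear_combination x ^ (2 * r - 1) * h3 + y ^ (2 * r - 1) * h4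

/-! ### The inverse matrix -/

/-- The candidate for the inverse of `𝒞`. -/
noncomputable def matCInv (K : ℕ) : Matrix (ZIdx K) (ZIdx K) ℚ :=
  Matrix.of fun r s => -2 * (bernoulliTransform (2 * K) (2 * K - 2 * r.1)).coeff (2 * s.1 - 1)

theorem ZIdx.bounds {K : ℕ} (r : ZIdx K) : 1 ≤ r.1 ∧ r.1 < K := by
  have := Finset.mem_Icc.1 r.2
  omega

-- The term of D with factor (1+2x)^(2K-2r) is odd under x ↦ -1-x and cancels; what survives is the
-- difference of the right-hand side.
open Polynomial in
theorem sum_matC_bernoulliTransform_sub_comp {K r : ℕ} (hr : 1 ≤ r) (hrK : r < K)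
    (G : ℚ[X]) (hG : G = ∑ s ∈ Finset.Icc 1 (K - 1), C (((2 * K - 2 * r).choose (2 * s - 1) : ℚ) +
        ((2 * K - 2 * r).choose (2 * K - 2 * s) : ℚ)) *
          bernoulliTransform (2 * K) (2 * K - 2 * s)) :
    G - G.comp (-X) = X ^ (2 * K - 1) - X ^ (2 * r - 1) := by
  have hev : Even (2 * K - 2 * r) := ⟨K - r, by omega⟩
  have ho : Odd (2 * r - 1) := ⟨r - 1, by omega⟩
  have ho' : Odd (2 * K - 1) := ⟨K - 1, by omega⟩
  refine sub_comp_neg_eq (D := fun x => ((1 + x + x) ^ (2 * K - 2 * r) *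
    (x ^ (2 * r - 1) + (1 + x) ^ (2 * r - 1)) +
      (x ^ (2 * r - 1) - (1 + x) ^ (2 * r - 1)) - 2 * x ^ (2 * K - 1)) / 2) (fun x => ?_) ?_ ?_
  -- At the point (1+x, x) the factor x - y of the generating polynomial becomes 1.
  · have := two_mul_sum_matC hr hrK (1 + x) x
    rw [add_sub_cancel_right, one_pow, one_mul] at this
    rw [hG]
    simp only [eval_finsetSum, eval_mul, eval_C]
    rw [← this, mul_div_cancel_left₀ _ two_ne_zero, ← Finset.sum_add_distrib]
    refine Finset.sum_congr rfl fun s hs => ?_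
    rw [Finset.mem_Icc] at hs
    rw [eval_one_add_bernoulliTransform (by omega),
      show 2 * K - 1 - (2 * K - 2 * s) = 2 * s - 1 by omega]
    ring
  · simp [zero_pow ho.pos.ne', zero_pow ho'.pos.ne']
  · intro x
    simp only [eval_sub, eval_pow, eval_X]
    rw [show 1 + -(1 + x) + -(1 + x) = -(1 + x + x) by ring, show 1 + -(1 + x) = -x by ring,
      hev.neg_pow, ho.neg_pow, ho.neg_pow, ho'.neg_pow]
    ring

theorem matC_mul_matCInv (K : ℕ) : matC K * matCInv K = 1 := by
  ext r t
  obtain ⟨hr, hrK⟩ := r.bounds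
  obtain ⟨ht, htK⟩ := t.bounds
  have h := congrArg (fun P => Polynomial.coeff P (2 * t.1 - 1))
    (sum_matC_bernoulliTransform_sub_comp hr hrK _ rfl)
  rw [coeff_sub_comp_neg_odd _ ⟨t.1 - 1, by omega⟩] at h
  simp only [Polynomial.finsetSum_coeff, Polynomial.coeff_C_mul, Polynomial.coeff_sub,
    Polynomial.coeff_X_pow] at h
  rw [if_neg (by omega : ¬ 2 * t.1 - 1 = 2 * K - 1)] at h
  rw [Matrix.mul_apply, Matrix.one_apply]
  simp only [matC_apply, matCInv, Matrix.of_apply]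
  rw [Finset.sum_coe_sort (Finset.Icc 1 (K - 1)) (fun s =>
    (((2 * K - 2 * r.1).choose (2 * s - 1) : ℚ) + ((2 * K - 2 * r.1).choose (2 * K - 2 * s) : ℚ)) *
      (-2 * (bernoulliTransform (2 * K) (2 * K - 2 * s)).coeff (2 * t.1 - 1)))]
  have hiff : (2 * t.1 - 1 = 2 * r.1 - 1) ↔ r = t := by
    rw [Subtype.ext_iff]; omega
  simp only [hiff] at h
  simp only [mul_left_comm _ (-2 : ℚ), ← Finset.mul_sum]
  linarith

-- The sum of the two transforms has a difference that is odd under x ↦ -1-x, so the sum is an even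
-- polynomial.
open Polynomial in
theorem bernoulliTransform_coeff_add {K r t : ℕ} (hr : 1 ≤ r) (hrK : r < K) (ht : 1 ≤ t) :
    (bernoulliTransform (2 * K) (2 * K - 2 * r)).coeff (2 * t - 1) +
      (bernoulliTransform (2 * K) (2 * r - 1)).coeff (2 * t - 1) = 0 := by
  have hev : Even (2 * K - 2 * r) := ⟨K - r, by omega⟩
  have ho : Odd (2 * r - 1) := ⟨r - 1, by omega⟩
  have h := sub_comp_neg_eq (G := bernoulliTransform (2 * K) (2 * K - 2 * r) +
    bernoulliTransform (2 * K) (2 * r - 1)) (Q := 0) (D := fun x =>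
      (1 + x) ^ (2 * K - 2 * r) * x ^ (2 * r - 1) + (1 + x) ^ (2 * r - 1) * x ^ (2 * K - 2 * r))
    (fun x => by
      rw [eval_add, eval_add, eval_one_add_bernoulliTransform (by omega),
        eval_one_add_bernoulliTransform (by omega),
        show 2 * K - 1 - (2 * K - 2 * r) = 2 * r - 1 by omega,
        show 2 * K - 1 - (2 * r - 1) = 2 * K - 2 * r by omega]
      ring) (by simp) (fun x => by
      rw [show 1 + -(1 + x) = -x by ring, hev.neg_pow, hev.neg_pow, ho.neg_pow, ho.neg_pow]
      simp only [eval_zero]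
      ring)
  have h2 := congrArg (fun P => coeff P (2 * t - 1)) h
  rw [coeff_sub_comp_neg_odd _ ⟨t - 1, by omega⟩] at h2
  simp only [coeff_add, coeff_zero] at h2
  linarith

theorem matC_inv (K : ℕ) : (matC K)⁻¹ = matCInv K :=
  Matrix.inv_eq_right_inv (matC_mul_matCInv K)

theorem isUnit_matC (K : ℕ) : IsUnit (matC K) :=
  IsUnit.of_mul_eq_one _ (matC_mul_matCInv K)

theorem matC_inv_apply {k K : ℕ} (hk : k = 2 * K + 1) (r s : ZIdx K) :
    (matC K)⁻¹ r s =
        -2 / (2 * (s.1 : ℚ) - 1) * ∑ n ∈ Finset.range (k - 2 * s.1 + 1),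
          ((k - 2 * r.1 - 1).choose (k - 2 * s.1 - n) : ℚ) *
            ((n + 2 * s.1 - 2).choose n : ℚ) * bernoulli n ∧
      (matC K)⁻¹ r s =
        2 / (2 * (s.1 : ℚ) - 1) * ∑ n ∈ Finset.range (k - 2 * s.1 + 1),
          ((2 * r.1 - 1).choose (k - 2 * s.1 - n) : ℚ) *
            ((n + 2 * s.1 - 2).choose n : ℚ) * bernoulli n := by
  obtain ⟨hr, hrK⟩ := r.bounds
  obtain ⟨hs, hsK⟩ := s.bounds
  subst hk
  rw [matC_inv, matCInv, Matrix.of_apply]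
  constructor
  · rw [coeff_bernoulliTransform hs (by omega),
      show 2 * K + 1 - 2 * r.1 - 1 = 2 * K - 2 * r.1 by omega]
    ring
  · rw [eq_neg_of_add_eq_zero_left (bernoulliTransform_coeff_add hr hrK hs),
      coeff_bernoulliTransform hs (by omega)]
    ring

/-! ### Partial fractions -/

/-- One half of the partial fraction decomposition of `u ^ (a + 1) * v ^ (b + 1)`, where
`u * v = w * (u + v)`. -/
def partialFractionSum {R : Type*} [CommRing R] (N b : ℕ) (w u : R) : R :=
  ∑ i ∈ Finset.range (N + 1), ((N - i).choose b : R) * w ^ (N + 1 - i) * u ^ (i + 1)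

section PartialFractions

variable {R : Type*} [CommRing R]

theorem partialFractionSum_succ_succ (N b : ℕ) (w u : R) :
    partialFractionSum (N + 1) (b + 1) w u =
      w * (partialFractionSum N b w u + partialFractionSum N (b + 1) w u) := by
  simp only [partialFractionSum]
  rw [Finset.sum_range_succ, ← Finset.sum_add_distrib, Finset.mul_sum]
  simp only [Nat.sub_self, Nat.choose_zero_succ, Nat.cast_zero, zero_mul, add_zero]
  refine Finset.sum_congr rfl fun i hi => ?_
  rw [Finset.mem_range] at hi
  rw [show N + 1 - i = N - i + 1 by omega, show N + 1 + 1 - i = N - i + 1 + 1 by omega,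
    Nat.choose_succ_succ]
  push_cast
  ring

theorem partialFractionSum_succ_zero (N : ℕ) (w u : R) :
    partialFractionSum (N + 1) 0 w u = w * (partialFractionSum N 0 w u + u ^ (N + 2)) := by
  simp only [partialFractionSum]
  rw [Finset.sum_range_succ, mul_add, Finset.mul_sum]
  congr 1
  · refine Finset.sum_congr rfl fun i hi => ?_
    rw [Finset.mem_range] at hi
    rw [show N + 1 + 1 - i = N + 1 - i + 1 by omega]
    simp only [Nat.choose_zero_right]
    ring
  · simp

theorem partialFractionSum_self_succ (N : ℕ) (w u : R) :
    partialFractionSum N (N + 1) w u = 0 :=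
  Finset.sum_eq_zero fun i _ => by
    rw [Nat.choose_eq_zero_of_lt (by omega), Nat.cast_zero, zero_mul, zero_mul]

/-- Replacing one factor uv by w(u+v) lowers a+b by one, and Pascal's rule gives both halves the
same recursion. It is applied to u = 1/p, v = 1/(n-p), w = 1/n. -/
theorem pow_mul_pow_eq_partialFractionSum {u v w : R} (h : u * v = w * (u + v)) (a b : ℕ) :
    u ^ (a + 1) * v ^ (b + 1) =
      partialFractionSum (a + b) b w u + partialFractionSum (a + b) a w v := by
  obtain ⟨N, hN⟩ : ∃ N, N = a + b := ⟨_, rfl⟩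
  induction N generalizing a b with
  | zero =>
    obtain rfl : a = 0 := by omega
    obtain rfl : b = 0 := by omega
    simp [partialFractionSum, h, mul_add]
  | succ N ih =>
    rw [← hN]
    rcases a with _ | a <;> rcases b with _ | b
    · omega
    · have h1 := ih 0 b (by omega)
      obtain rfl : N = b := by omega
      rw [partialFractionSum_succ_succ, partialFractionSum_succ_zero,
        partialFractionSum_self_succ]
      rw [zero_add, zero_add] at h1
      linear_combination w * h1 + v ^ (N + 1) * h
    · have h1 := ih a 0 (by omega)
      obtain rfl : N = a := by omega
      rw [partialFractionSum_succ_succ, partialFractionSum_succ_zero,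
        partialFractionSum_self_succ]
      rw [add_zero] at h1
      linear_combination w * h1 + u ^ (N + 1) * h
    · have h1 := ih a (b + 1) (by omega)
      have h2 := ih (a + 1) b (by omega)
      rw [show a + (b + 1) = N by omega] at h1
      rw [show a + 1 + b = N by omega] at h2
      rw [partialFractionSum_succ_succ, partialFractionSum_succ_succ]
      linear_combination w * h1 + w * h2 + u ^ (a + 1) * v ^ (b + 1) * h

end PartialFractions

/-! ### Sums over the integers -/

theorem HasSum.of_eq {ι : Type*} {f g : ι → ℝ} {s t : ℝ} (h : HasSum f s)
    (hf : ∀ i, g i = f i) (hs : t = s) : HasSum g t := by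
  rw [hs, funext hf]
  exact h

theorem hasSum_zetaValue {a : ℕ} (ha : 2 ≤ a) :
    HasSum (fun m : ℕ => (((m : ℝ) + 1)⁻¹) ^ a) (zetaValue a) := by
  have h : Summable (fun n : ℕ => 1 / ((n : ℕ) : ℝ) ^ a) :=
    Real.summable_one_div_nat_pow.mpr (by omega)
  have h1 := ((summable_nat_add_iff 1).2 h).hasSum
  have h2 : (fun m : ℕ => (((m : ℝ) + 1)⁻¹) ^ a) = fun m : ℕ => 1 / ((m + 1 : ℕ) : ℝ) ^ a := by
    funext m
    push_cast
    rw [inv_pow, one_div]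
  rw [h2]
  exact h1

/-- The value of `∑_{p ≠ 0} 1 / p ^ a` over the integers. -/
noncomputable def intZetaValue (a : ℕ) : ℝ := if Even a then 2 * zetaValue a else 0

theorem hasSum_intZetaValue {a : ℕ} (ha : 2 ≤ a) :
    HasSum (fun p : ℤ => ((p : ℝ)⁻¹) ^ a) (intZetaValue a) := by
  have h1 := hasSum_zetaValue ha
  have h2 : HasSum (fun m : ℕ => (((m : ℤ) : ℝ)⁻¹) ^ a) (zetaValue a) := by
    rw [← hasSum_nat_add_iff' 1]
    simpa [zero_pow (by omega : a ≠ 0)] using h1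
  have h3 : HasSum (fun m : ℕ => (((-((m : ℤ) + 1) : ℤ) : ℝ)⁻¹) ^ a) ((-1) ^ a * zetaValue a) := by
    refine (h1.mul_left ((-1 : ℝ) ^ a)).of_eq (fun m => ?_) rfl
    rw [← mul_pow]
    push_cast
    congr 1
    rw [inv_neg]; ring
  refine (HasSum.of_nat_of_neg_add_one (f := fun p : ℤ => ((p : ℝ)⁻¹) ^ a) h2 h3).of_eq (fun _ => rfl) ?_
  unfold intZetaValue
  split_ifs with he
  · rw [he.neg_one_pow]; ring
  · rw [(Nat.not_even_iff_odd.1 he).neg_one_pow]; ring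

theorem hasSum_inv_sub_inv_succ :
    HasSum (fun m : ℕ => ((m : ℝ) + 1)⁻¹ - ((m : ℝ) + 1 + 1)⁻¹) 1 := by
  rw [hasSum_iff_tendsto_nat_of_nonneg]
  · have h : ∀ n : ℕ, ∑ m ∈ Finset.range n, (((m : ℝ) + 1)⁻¹ - ((m : ℝ) + 1 + 1)⁻¹) =
        1 - 1 / ((n : ℝ) + 1) := by
      intro n
      have := Finset.sum_range_sub' (fun m : ℕ => ((m : ℝ) + 1)⁻¹) n
      push_cast at this
      rw [this]; simp
    simp only [h]
    simpa using tendsto_one_div_add_atTop_nhds_zero_nat (𝕜 := ℝ) |>.const_sub 1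
  · intro m
    rw [sub_nonneg]
    gcongr
    linarith

theorem hasSum_int_inv_sub_inv_pred :
    HasSum (fun p : ℤ => (p : ℝ)⁻¹ - ((p : ℝ) - 1)⁻¹) 0 := by
  have h := hasSum_inv_sub_inv_succ
  have h1 : HasSum (fun m : ℕ => (((m : ℤ) : ℝ))⁻¹ - (((m : ℤ) : ℝ) - 1)⁻¹) 1 := by
    -- With 0⁻¹ = 0 the terms p = 0 and p = 1 both equal 1; those with p ≥ 2 telescope to -1.
    rw [← hasSum_nat_add_iff' 2]
    refine h.neg.of_eq (fun m => ?_) ?_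
    · push_cast
      rw [show (m : ℝ) + 2 - 1 = m + 1 by ring, show (m : ℝ) + 2 = m + 1 + 1 by ring]
      ring
    · norm_num [Finset.sum_range_succ]
  have h2 : HasSum (fun m : ℕ => (((-((m : ℤ) + 1) : ℤ) : ℝ))⁻¹ -
      (((-((m : ℤ) + 1) : ℤ) : ℝ) - 1)⁻¹) (-1) := by
    refine h.neg.of_eq (fun m => ?_) rfl
    push_cast
    rw [show -((m : ℝ) + 1) - 1 = -(m + 1 + 1) by ring, inv_neg, inv_neg]
    ring
  exact (HasSum.of_nat_of_neg_add_one (f := fun p : ℤ => (p : ℝ)⁻¹ - ((p : ℝ) - 1)⁻¹)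
    h1 h2).of_eq (fun _ => rfl) (add_neg_cancel 1).symm

/-- Neither summand is summable alone. Passing from n to n+1 shifts p by one and adds a telescoping
series of sum 0. -/
theorem hasSum_int_inv_add_inv_sub (n : ℕ) :
    HasSum (fun p : ℤ => (p : ℝ)⁻¹ + ((n : ℝ) - p)⁻¹) 0 := by
  induction n with
  | zero =>
    refine hasSum_zero.of_eq (fun p => ?_) rfl
    rw [Nat.cast_zero, zero_sub, inv_neg, add_neg_cancel]
  | succ n ih =>
    have h1 := (Equiv.subRight (1 : ℤ)).hasSum_iff.2 ih
    refine (hasSum_int_inv_sub_inv_pred.add h1).of_eq (fun p => ?_) (add_zero 0).symm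
    simp only [Function.comp, Equiv.subRight_apply]
    push_cast
    rw [show (n : ℝ) + 1 - p = n - (p - 1) by ring]
    ring

theorem hasSum_intZetaValue_sub {a : ℕ} (ha : 2 ≤ a) (n : ℕ) :
    HasSum (fun p : ℤ => (((n : ℝ) - p)⁻¹) ^ a) (intZetaValue a) := by
  have h1 := (Equiv.subLeft (n : ℤ)).hasSum_iff.2 (hasSum_intZetaValue ha)
  exact h1.of_eq (fun p => by simp) rfl

theorem hasSum_partialFractionSum (a b n : ℕ) :
    HasSum (fun p : ℤ => partialFractionSum (a + b) b (n : ℝ)⁻¹ (p : ℝ)⁻¹ +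
        partialFractionSum (a + b) a (n : ℝ)⁻¹ ((n : ℝ) - p)⁻¹)
      (∑ i ∈ Finset.range (a + b), (((a + b - (i + 1)).choose b : ℝ) +
        ((a + b - (i + 1)).choose a : ℝ)) * ((n : ℝ)⁻¹) ^ (a + b - i) * intZetaValue (i + 2)) := by
  -- The first-order terms of the two halves have equal coefficients, so they can be paired, and
  -- they contribute nothing.
  have h0 := (hasSum_int_inv_add_inv_sub n).mul_left
    (((a + b).choose b : ℝ) * ((n : ℝ)⁻¹) ^ (a + b + 1))
  have h1 : HasSum (fun p : ℤ => ∑ i ∈ Finset.range (a + b),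
      (((a + b - (i + 1)).choose b : ℝ) * ((n : ℝ)⁻¹) ^ (a + b - i) * ((p : ℝ)⁻¹) ^ (i + 2) +
        ((a + b - (i + 1)).choose a : ℝ) * ((n : ℝ)⁻¹) ^ (a + b - i) *
          (((n : ℝ) - p)⁻¹) ^ (i + 2)))
      (∑ i ∈ Finset.range (a + b),
        (((a + b - (i + 1)).choose b : ℝ) * ((n : ℝ)⁻¹) ^ (a + b - i) * intZetaValue (i + 2) +
        ((a + b - (i + 1)).choose a : ℝ) * ((n : ℝ)⁻¹) ^ (a + b - i) * intZetaValue (i + 2))) :=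
    hasSum_sum fun i _ => ((hasSum_intZetaValue (by omega)).mul_left _).add
      ((hasSum_intZetaValue_sub (by omega) n).mul_left _)
  refine (h0.add h1).of_eq (fun p => ?_) ?_
  · rw [partialFractionSum, partialFractionSum, Finset.sum_range_succ',
      Finset.sum_range_succ' _ (a + b), Finset.sum_add_distrib]
    simp only [Nat.add_sub_add_right, Nat.sub_zero, zero_add, pow_one]
    rw [← Nat.choose_symm_add (a := a) (b := b)]
    ring
  · rw [mul_zero, zero_add]
    exact Finset.sum_congr rfl fun i _ => by ring

theorem partialFractionSum_diag (N b : ℕ) (w : ℝ) :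
    partialFractionSum N b w w = partialFractionSum N b 1 1 * w ^ (N + 2) := by
  simp only [partialFractionSum, one_pow, mul_one]
  rw [Finset.sum_mul]
  refine Finset.sum_congr rfl fun i hi => ?_
  rw [Finset.mem_range] at hi
  rw [mul_assoc, ← pow_add, show N + 1 - i + (i + 1) = N + 2 by omega]

theorem hasSum_inv_pow_mul_inv_pow_sub (a b : ℕ) {n : ℕ} (hn : n ≠ 0) :
    HasSum (fun p : ℤ => ((p : ℝ)⁻¹) ^ (a + 1) * (((n : ℝ) - p)⁻¹) ^ (b + 1))
      (∑ i ∈ Finset.range (a + b), (((a + b - (i + 1)).choose b : ℝ) +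
        ((a + b - (i + 1)).choose a : ℝ)) * ((n : ℝ)⁻¹) ^ (a + b - i) * intZetaValue (i + 2) -
        (partialFractionSum (a + b) a 1 1 + partialFractionSum (a + b) b 1 1) *
          ((n : ℝ)⁻¹) ^ (a + b + 2)) := by
  have hn' : (n : ℝ) ≠ 0 := by exact_mod_cast hn
  -- At p = 0 and p = n the left side is 0 by the convention 0⁻¹ = 0, but one half of the
  -- decomposition survives; these two values are subtracted.
  have h := (hasSum_partialFractionSum a b n).sub
    ((hasSum_ite_eq (0 : ℤ) (partialFractionSum (a + b) a (n : ℝ)⁻¹ (n : ℝ)⁻¹)).add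
    (hasSum_ite_eq (n : ℤ) (partialFractionSum (a + b) b (n : ℝ)⁻¹ (n : ℝ)⁻¹)))
  refine h.of_eq (fun p => ?_) ?_
  · have hz : ∀ N c : ℕ, partialFractionSum N c (n : ℝ)⁻¹ 0 = 0 := fun N c =>
      Finset.sum_eq_zero fun i _ => by rw [zero_pow (by omega), mul_zero]
    by_cases hp : p = 0
    · subst hp
      have : (0 : ℤ) ≠ n := by exact_mod_cast hn.symm
      simp [hz, this]
    · by_cases hpn : p = n
      · subst hpn
        simp [hz, hn]
      · have h1 : (p : ℝ) ≠ 0 := by exact_mod_cast hp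
        have h2 : (n : ℝ) - p ≠ 0 := by
          rw [sub_ne_zero]
          exact fun h => hpn (by exact_mod_cast h.symm)
        rw [if_neg hp, if_neg hpn, add_zero, sub_zero]
        refine pow_mul_pow_eq_partialFractionSum ?_ a b
        field_simp
        ring
  · rw [partialFractionSum_diag _ a (n : ℝ)⁻¹, partialFractionSum_diag _ b (n : ℝ)⁻¹]
    ring

/-! ### Lattice sums and double zeta values -/

theorem hasSum_doubleZeta {a b : ℕ} (ha : 2 ≤ a) (hb : 2 ≤ b) :
    HasSum (fun m : {m : ℕ × ℕ // 0 < m.1 ∧ m.1 < m.2} =>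
      ((m.1.1 : ℝ)⁻¹) ^ a * ((m.1.2 : ℝ)⁻¹) ^ b) (doubleZeta a b) :=
  (summable_doubleZeta ha hb).hasSum.of_eq (fun m => by
    rw [inv_pow, inv_pow, ← mul_inv, one_div]) rfl

theorem hasSum_zetaValue_mul {a b : ℕ} (ha : 2 ≤ a) (hb : 2 ≤ b) :
    HasSum (fun m : ℕ × ℕ => (((m.1 : ℝ) + 1)⁻¹) ^ a * (((m.2 : ℝ) + 1)⁻¹) ^ b)
      (zetaValue a * zetaValue b) := by
  have h1 := hasSum_zetaValue ha
  have h2 := hasSum_zetaValue hb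
  exact h1.mul h2 (h1.summable.mul_of_nonneg h2.summable (fun n => by positivity)
    (fun n => by positivity))

theorem Function.Injective.hasSum_indicator {ι κ : Type*} {g : ι → κ} (hg : Function.Injective g)
    {f : κ → ℝ} {S : Set κ} (hS : Set.range g = S) {s : ℝ} (h : HasSum (fun i => f (g i)) s) :
    HasSum (S.indicator f) s := by
  rw [← hS]
  refine (hg.hasSum_iff fun x hx => Set.indicator_of_notMem hx f).1
    (h.of_eq (fun i => ?_) rfl)
  exact Set.indicator_of_mem (Set.mem_range_self i) f

/-- The stuffle product: the quadrant splits into m₁ < m₂, m₁ > m₂ and the diagonal. -/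
theorem zetaValue_mul_zetaValue {a b : ℕ} (ha : 2 ≤ a) (hb : 2 ≤ b) :
    zetaValue a * zetaValue b = doubleZeta a b + doubleZeta b a + zetaValue (a + b) := by
  set f : ℕ × ℕ → ℝ := fun m => ((m.1 : ℝ)⁻¹) ^ a * ((m.2 : ℝ)⁻¹) ^ b with hf
  have h0 : HasSum ({m : ℕ × ℕ | 0 < m.1 ∧ 0 < m.2}.indicator f) (zetaValue a * zetaValue b) := by
    refine Function.Injective.hasSum_indicator (g := fun m : ℕ × ℕ => (m.1 + 1, m.2 + 1))
      (fun m m' h => by simpa [Prod.ext_iff] using h) ?_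
      ((hasSum_zetaValue_mul ha hb).of_eq (fun m => by simp [hf]) rfl)
    ext ⟨x, y⟩
    simp only [Set.mem_range, Prod.mk.injEq, Prod.exists, Set.mem_ofPred_eq]
    exact ⟨fun ⟨i, j, h1, h2⟩ => by omega, fun h => ⟨x - 1, y - 1, by omega, by omega⟩⟩
  have h1 : HasSum ({m : ℕ × ℕ | 0 < m.1 ∧ m.1 < m.2}.indicator f) (doubleZeta a b) :=
    Function.Injective.hasSum_indicator Subtype.val_injective Subtype.range_val
      (hasSum_doubleZeta ha hb)
  have h2 : HasSum ({m : ℕ × ℕ | 0 < m.2 ∧ m.2 < m.1}.indicator f) (doubleZeta b a) := by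
    refine Function.Injective.hasSum_indicator
      (g := fun m : {m : ℕ × ℕ // 0 < m.1 ∧ m.1 < m.2} => m.1.swap)
      (Prod.swap_injective.comp Subtype.val_injective) ?_
      ((hasSum_doubleZeta hb ha).of_eq (fun m => by simp [hf, mul_comm]) rfl)
    ext ⟨x, y⟩
    simp only [Set.mem_range, Subtype.exists, Prod.exists, Set.mem_ofPred_eq, Prod.swap_prod_mk,
      Prod.mk.injEq]
    exact ⟨fun ⟨i, j, h, h1, h2⟩ => by omega, fun h => ⟨y, x, h, rfl, rfl⟩⟩
  have h3 : HasSum ({m : ℕ × ℕ | 0 < m.1 ∧ m.1 = m.2}.indicator f) (zetaValue (a + b)) := by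
    refine Function.Injective.hasSum_indicator (g := fun m : ℕ => (m + 1, m + 1))
      (fun m m' h => by simpa using h) ?_
      ((hasSum_zetaValue (by omega : 2 ≤ a + b)).of_eq (fun m => by simp [hf, pow_add]) rfl)
    ext ⟨x, y⟩
    simp only [Set.mem_range, Prod.mk.injEq, Set.mem_ofPred_eq]
    exact ⟨fun ⟨i, h1, h2⟩ => by omega, fun h => ⟨x - 1, by omega, by omega⟩⟩
  refine h0.unique (((h1.add h2).add h3).of_eq (fun m => ?_) rfl)
  simp only [Set.indicator_apply, Set.mem_ofPred_eq]
  rcases lt_trichotomy m.1 m.2 with h | h | h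
  · by_cases h0 : 0 < m.1
    · simp [h0, h, h0.trans h, h.ne, h.not_gt]
    · simp [h0, h.not_gt]
  · by_cases h0 : 0 < m.1
    · simp [h, h ▸ h0]
    · simp [h, h ▸ h0]
  · by_cases h0 : 0 < m.2
    · simp [h0, h, h0.trans h, h.ne', h.not_gt]
    · simp [h0, h.not_gt, h.ne']

/-- The sum of `1 / (p ^ a * q ^ b)` over nonzero integers with `p + q > 0`, by the signs of `p`
and `q`. -/
theorem hasSum_half_plane {a b : ℕ} (ha : 2 ≤ a) (hb : 2 ≤ b) :
    HasSum (fun m : ℕ × ℤ => ((m.2 : ℝ)⁻¹) ^ a * ((((m.1 + 1 : ℕ) : ℝ) - m.2)⁻¹) ^ b)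
      (zetaValue a * zetaValue b + (-1) ^ b * doubleZeta b a + (-1) ^ a * doubleZeta a b) := by
  set f : ℤ × ℤ → ℝ := fun m => ((m.1 : ℝ)⁻¹) ^ a * ((m.2 : ℝ)⁻¹) ^ b with hf
  have h0 : HasSum ({m : ℤ × ℤ | 0 < m.1 ∧ 0 < m.2}.indicator f) (zetaValue a * zetaValue b) := by
    refine Function.Injective.hasSum_indicator
      (g := fun m : ℕ × ℕ => ((m.1 : ℤ) + 1, (m.2 : ℤ) + 1))
      (fun m m' h => by simpa [Prod.ext_iff] using h) ?_
      ((hasSum_zetaValue_mul ha hb).of_eq (fun m => by simp [hf]) rfl)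
    ext ⟨x, y⟩
    simp only [Set.mem_range, Prod.mk.injEq, Prod.exists, Set.mem_ofPred_eq]
    exact ⟨fun ⟨i, j, h1, h2⟩ => by omega,
      fun h => ⟨(x - 1).toNat, (y - 1).toNat, by omega, by omega⟩⟩
  have h1 : HasSum ({m : ℤ × ℤ | m.1 < 0 ∧ 0 < m.1 + m.2}.indicator f)
      ((-1) ^ a * doubleZeta a b) := by
    refine Function.Injective.hasSum_indicator
      (g := fun m : {m : ℕ × ℕ // 0 < m.1 ∧ m.1 < m.2} => (-(m.1.1 : ℤ), (m.1.2 : ℤ)))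
      (fun m m' h => by simpa [Subtype.ext_iff, Prod.ext_iff] using h) ?_
      (((hasSum_doubleZeta ha hb).mul_left _).of_eq (fun m => ?_) rfl)
    · ext ⟨x, y⟩
      simp only [Set.mem_range, Subtype.exists, Prod.exists, Set.mem_ofPred_eq, Prod.mk.injEq]
      exact ⟨fun ⟨i, j, h, h1, h2⟩ => by omega,
        fun h => ⟨(-x).toNat, y.toNat, by omega, by omega, by omega⟩⟩
    · simp only [hf, Int.cast_neg, Int.cast_natCast]
      rw [inv_neg, neg_pow, mul_assoc]
  have h2 : HasSum ({m : ℤ × ℤ | m.2 < 0 ∧ 0 < m.1 + m.2}.indicator f)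
      ((-1) ^ b * doubleZeta b a) := by
    refine Function.Injective.hasSum_indicator
      (g := fun m : {m : ℕ × ℕ // 0 < m.1 ∧ m.1 < m.2} => ((m.1.2 : ℤ), -(m.1.1 : ℤ)))
      (fun m m' h => by simpa [Subtype.ext_iff, Prod.ext_iff, and_comm] using h) ?_
      (((hasSum_doubleZeta hb ha).mul_left _).of_eq (fun m => ?_) rfl)
    · ext ⟨x, y⟩
      simp only [Set.mem_range, Subtype.exists, Prod.exists, Set.mem_ofPred_eq, Prod.mk.injEq]
      exact ⟨fun ⟨i, j, h, h1, h2⟩ => by omega,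
        fun h => ⟨(-y).toNat, x.toNat, by omega, by omega, by omega⟩⟩
    · simp only [hf, Int.cast_neg, Int.cast_natCast]
      rw [inv_neg, neg_pow]; ring
  -- The lines p + q = n + 1 sweep out the half plane; points on the axes contribute 0 because 0⁻¹ =
  -- 0.
  have hinj : Function.Injective (fun m : ℕ × ℤ => (m.2, ((m.1 + 1 : ℕ) : ℤ) - m.2)) := by
    rintro ⟨n, p⟩ ⟨n', p'⟩ h
    simp only [Prod.mk.injEq] at h ⊢
    omega
  have h3 := (h0.add h2).add h1
  rw [← hinj.hasSum_iff] at h3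
  · refine h3.of_eq (fun m => ?_) rfl
    obtain ⟨n, p⟩ := m
    simp only [Function.comp, Set.indicator_apply, Set.mem_ofPred_eq]
    have hpos : 0 < p + (((n + 1 : ℕ) : ℤ) - p) := by omega
    have hv : f (p, ((n + 1 : ℕ) : ℤ) - p) =
        ((p : ℝ)⁻¹) ^ a * ((((n + 1 : ℕ) : ℝ) - p)⁻¹) ^ b := by
      simp [hf]
    rw [← hv]
    rcases lt_trichotomy p 0 with h | h | h
    · rw [if_neg (by omega), if_neg (by omega), if_pos (by omega)]; ring
    · rw [if_neg (by omega), if_neg (by omega), if_neg (by omega), h]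
      simp [hf, zero_pow (by omega : a ≠ 0)]
    · rcases lt_trichotomy (((n + 1 : ℕ) : ℤ) - p) 0 with h' | h' | h'
      · rw [if_neg (by omega), if_pos (by omega), if_neg (by omega)]; ring
      · rw [if_neg (by omega), if_neg (by omega), if_neg (by omega), h']
        simp [hf, zero_pow (by omega : b ≠ 0)]
      · rw [if_pos (by omega), if_neg (by omega), if_neg (by omega)]; ring
  · rintro ⟨p, q⟩ hpq
    have hle : p + q ≤ 0 := by
      by_contra hc
      exact hpq ⟨((p + q - 1).toNat, p), by
        simp only [Prod.mk.injEq, true_and]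
        omega⟩
    simp only [Set.indicator_apply, Set.mem_ofPred_eq]
    rw [if_neg (by omega), if_neg (by omega), if_neg (by omega)]
    ring

/-- The half-plane sum is summed by signs on the left and line by line on the right. -/
theorem half_plane_sum_eq {a b : ℕ} (ha : 1 ≤ a) (hb : 1 ≤ b) :
    zetaValue (a + 1) * zetaValue (b + 1) + (-1) ^ (b + 1) * doubleZeta (b + 1) (a + 1) +
        (-1) ^ (a + 1) * doubleZeta (a + 1) (b + 1) =
      ∑ i ∈ Finset.range (a + b), (((a + b - (i + 1)).choose b : ℝ) +
        ((a + b - (i + 1)).choose a : ℝ)) * zetaValue (a + b - i) * intZetaValue (i + 2) -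
        (partialFractionSum (a + b) a 1 1 + partialFractionSum (a + b) b 1 1) *
          zetaValue (a + b + 2) := by
  have h0 := hasSum_half_plane (by omega : 2 ≤ a + 1) (by omega : 2 ≤ b + 1)
  have h1 := HasSum.prod_fiberwise (g := fun n : ℕ => ∑ i ∈ Finset.range (a + b),
      (((a + b - (i + 1)).choose b : ℝ) + ((a + b - (i + 1)).choose a : ℝ)) *
        (((n + 1 : ℕ) : ℝ)⁻¹) ^ (a + b - i) * intZetaValue (i + 2) -
      (partialFractionSum (a + b) a 1 1 + partialFractionSum (a + b) b 1 1) *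
        (((n + 1 : ℕ) : ℝ)⁻¹) ^ (a + b + 2)) h0
    (fun n => hasSum_inv_pow_mul_inv_pow_sub a b (n := n + 1) n.succ_ne_zero)
  refine h1.unique (HasSum.sub (hasSum_sum fun i hi => ?_) ?_)
  · rw [Finset.mem_range] at hi
    refine HasSum.mul_right _ ?_
    -- The last index would involve the divergent ζ(1), but its binomials vanish since a, b ≥ 1.
    by_cases hc : i + 1 = a + b
    · rw [hc, Nat.sub_self, Nat.choose_eq_zero_of_lt (by omega),
        Nat.choose_eq_zero_of_lt (by omega)]
      simp
    · exact ((hasSum_zetaValue (by omega : 2 ≤ a + b - i)).of_eq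
        (fun n => by push_cast; rfl) rfl).mul_left _
  · exact ((hasSum_zetaValue (by omega : 2 ≤ a + b + 2)).of_eq
        (fun n => by push_cast; rfl) rfl).mul_left _

/-! ### Reduction of double zeta values in odd weight, and inversion -/

theorem sum_range_eq_sum_even_of_odd_eq_zero (F : ℕ → ℝ) (hF : ∀ i, F (2 * i + 1) = 0) (L : ℕ) :
    ∑ i ∈ Finset.range (2 * L + 1), F i = ∑ s ∈ Finset.range (L + 1), F (2 * s) := by
  induction L with
  | zero => simp
  | succ L ih =>
    rw [show 2 * (L + 1) + 1 = 2 * L + 1 + 1 + 1 by ring, Finset.sum_range_succ,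
      Finset.sum_range_succ, ih, hF, Finset.sum_range_succ _ (L + 1)]
    rw [add_zero, show 2 * (L + 1) = 2 * L + 1 + 1 by ring]

theorem exists_cast_partialFractionSum (N b : ℕ) :
    ∃ q : ℚ, (partialFractionSum N b 1 1 : ℝ) = q :=
  ⟨partialFractionSum N b 1 1, by simp [partialFractionSum]⟩

/-- Double zeta values of odd weight and even first argument are combinations of products of
zeta values, up to a rational multiple of `ζ(k)`. -/
theorem exists_doubleZeta_eq {K : ℕ} (r : ZIdx K) :
    ∃ q : ℚ, doubleZeta (2 * r.1) (2 * K + 1 - 2 * r.1) =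
      ∑ s : ZIdx K, ((matC K s r : ℚ) : ℝ) *
        (zetaValue (2 * s.1) * zetaValue (2 * K + 1 - 2 * s.1)) + q * zetaValue (2 * K + 1) := by
  obtain ⟨hr, hrK⟩ := r.bounds
  obtain ⟨a, ha⟩ : ∃ a, a = 2 * r.1 - 1 := ⟨_, rfl⟩
  obtain ⟨b, hb⟩ : ∃ b, b = 2 * K - 2 * r.1 := ⟨_, rfl⟩
  have hev : Even (a + 1) := ⟨r.1, by omega⟩
  have hod : Odd (b + 1) := ⟨K - r.1, by omega⟩
  have h1 := half_plane_sum_eq (by omega : 1 ≤ a) (by omega : 1 ≤ b)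
  -- As a+1 is even and b+1 odd, the stuffle product cancels ζ(b+1,a+1) and leaves 2ζ(a+1,b+1) +
  -- ζ(k).
  rw [zetaValue_mul_zetaValue (by omega) (by omega), hev.neg_one_pow, hod.neg_one_pow,
    show a + 1 + (b + 1) = 2 * K + 1 by omega, show a + b + 2 = 2 * K + 1 by omega] at h1
  obtain ⟨q₁, hq₁⟩ := exists_cast_partialFractionSum (a + b) a
  obtain ⟨q₂, hq₂⟩ := exists_cast_partialFractionSum (a + b) b
  -- Odd i drop out because the integer sum vanishes; even i = 2(s-1) gives entry (s,r) of 𝒞, and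
  -- the final index has zero coefficient.
  have hsum : ∑ i ∈ Finset.range (a + b), (((a + b - (i + 1)).choose b : ℝ) +
        ((a + b - (i + 1)).choose a : ℝ)) * zetaValue (a + b - i) * intZetaValue (i + 2) =
      2 * ∑ s : ZIdx K, ((matC K s r : ℚ) : ℝ) *
        (zetaValue (2 * s.1) * zetaValue (2 * K + 1 - 2 * s.1)) := by
    simp only [matC_apply]
    rw [Finset.sum_coe_sort (Finset.Icc 1 (K - 1)) (fun s =>
      (((((2 * K - 2 * s).choose (2 * r.1 - 1) : ℚ) +
        ((2 * K - 2 * s).choose (2 * K - 2 * r.1) : ℚ) : ℚ) : ℝ) *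
        (zetaValue (2 * s) * zetaValue (2 * K + 1 - 2 * s)))), ← ha, ← hb,
      show Finset.Icc 1 (K - 1) = Finset.Ico 1 K by
        ext; simp only [Finset.mem_Icc, Finset.mem_Ico]; omega,
      Finset.sum_Ico_eq_sum_range, show a + b = 2 * (K - 1) + 1 by omega,
      sum_range_eq_sum_even_of_odd_eq_zero, Finset.sum_range_succ, Finset.mul_sum]
    · rw [Nat.sub_self, Nat.choose_eq_zero_of_lt (by omega : 0 < b),
        Nat.choose_eq_zero_of_lt (by omega : 0 < a), Nat.cast_zero, add_zero, zero_mul, zero_mul,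
        add_zero]
      refine Finset.sum_congr rfl fun s hs => ?_
      rw [Finset.mem_range] at hs
      rw [intZetaValue, if_pos ⟨s + 1, by ring⟩,
        show 2 * (K - 1) + 1 - (2 * s + 1) = 2 * K - 2 * (1 + s) by omega,
        show 2 * (K - 1) + 1 - 2 * s = 2 * K + 1 - 2 * (1 + s) by omega,
        show 2 * s + 2 = 2 * (1 + s) by ring]
      push_cast
      ring
    · intro i
      rw [intZetaValue, if_neg (Nat.not_even_iff_odd.2 ⟨i + 1, by ring⟩), mul_zero]
  refine ⟨-(1 + q₁ + q₂) / 2, ?_⟩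
  rw [hsum, hq₁, hq₂] at h1
  rw [show 2 * K + 1 - 2 * r.1 = b + 1 by omega, show 2 * r.1 = a + 1 by omega]
  push_cast
  linear_combination h1 / 2

theorem zetaValue_mul_smodEq {k K : ℕ} (hk : k = 2 * K + 1) (s : ZIdx K) :
    zetaValue (2 * s.1) * zetaValue (k - 2 * s.1) ≡
      ∑ r : ZIdx K, (((matC K)⁻¹ r s : ℚ) : ℝ) * doubleZeta (2 * r.1) (k - 2 * r.1)
      [SMOD Submodule.span ℚ {zetaValue k}] := by
  subst hk
  choose q hq using fun r : ZIdx K => exists_doubleZeta_eq r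
  have hmul : matC K * (matC K)⁻¹ = 1 := by rw [matC_inv, matC_mul_matCInv]
  have hone : ∀ t : ZIdx K, ∑ r, ((matC K t r : ℚ) : ℝ) * (((matC K)⁻¹ r s : ℚ) : ℝ) =
      if t = s then 1 else 0 := by
    intro t
    have := congrFun (congrFun hmul t) s
    rw [Matrix.mul_apply, Matrix.one_apply] at this
    have h2 := congrArg (fun x : ℚ => (x : ℝ)) this
    simp only [Rat.cast_sum, Rat.cast_mul] at h2
    rw [h2]
    split_ifs <;> simp
  rw [SModEq.sub_mem, Submodule.mem_span_singleton]
  refine ⟨-∑ r, (matC K)⁻¹ r s * q r, ?_⟩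
  have key : ∑ r : ZIdx K, (((matC K)⁻¹ r s : ℚ) : ℝ) *
      ∑ t : ZIdx K, ((matC K t r : ℚ) : ℝ) *
        (zetaValue (2 * t.1) * zetaValue (2 * K + 1 - 2 * t.1)) =
      zetaValue (2 * s.1) * zetaValue (2 * K + 1 - 2 * s.1) := by
    simp only [Finset.mul_sum]
    rw [Finset.sum_comm]
    trans ∑ t : ZIdx K, (if t = s then (1 : ℝ) else 0) *
        (zetaValue (2 * t.1) * zetaValue (2 * K + 1 - 2 * t.1))
    · refine Finset.sum_congr rfl fun t _ => ?_
      rw [← hone t, Finset.sum_mul]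
      exact Finset.sum_congr rfl fun r _ => by ring
    · simp
  simp only [hq, mul_add, Finset.sum_add_distrib]
  rw [key, Rat.smul_def]
  push_cast
  rw [neg_mul, Finset.sum_mul, sub_add_cancel_left]
  congr 1
  exact Finset.sum_congr rfl fun r _ => by ring

theorem corollary2 (k K : ℕ) (hk : k = 2 * K + 1) (hk5 : 5 ≤ k) :
    IsUnit (matC K) ∧
    (∀ r s : ZIdx K,
      (matC K)⁻¹ r s =
        -2 / (2 * (s.1 : ℚ) - 1) * ∑ n ∈ Finset.range (k - 2 * s.1 + 1),
          ((k - 2 * r.1 - 1).choose (k - 2 * s.1 - n) : ℚ) *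
            ((n + 2 * s.1 - 2).choose n : ℚ) * bernoulli n ∧
      (matC K)⁻¹ r s =
        2 / (2 * (s.1 : ℚ) - 1) * ∑ n ∈ Finset.range (k - 2 * s.1 + 1),
          ((2 * r.1 - 1).choose (k - 2 * s.1 - n) : ℚ) *
            ((n + 2 * s.1 - 2).choose n : ℚ) * bernoulli n) ∧
    (∀ s : ZIdx K,
      zetaValue (2 * s.1) * zetaValue (k - 2 * s.1) ≡
        ∑ r : ZIdx K, (((matC K)⁻¹ r s : ℚ) : ℝ) * doubleZeta (2 * r.1) (k - 2 * r.1)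
        [SMOD Submodule.span ℚ {zetaValue k}]) :=
  ⟨isUnit_matC K, matC_inv_apply hk, zetaValue_mul_smodEq hk⟩
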